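/- Let $n\ge 3$, $\tau\in[0,\frac{\pi}{2}]$, $C_0\in\mathbb R$, and let $B_1$ be the unit ball of $\mathbb R^n$ centred at the origin. Put $a=\cot\tau$ and $b=\sqrt{|\cot^2\tau-1|}$ (for $\tau>0$), and for $\lambda=(\lambda_1,\dots,\lambda_n)$ $$F_\tau(\lambda)=\begin{cases}\frac1n\sum_{i=1}^n\ln\lambda_i,&\tau=0,\\[2pt] \frac{\sqrt{a^2+1}}{2b}\sum_{i=1}^n\ln\frac{\lambda_i+a-b}{\lambda_i+a+b},&0<\tau<\frac\pi4,\\[2pt] -\sqrt2\sum_{i=1}^n\frac1{1+\lambda_i},&\tau=\frac\pi4,\\[2pt] \frac{\sqrt{a^2+1}}{b}\sum_{i=1}^n\arctan\frac{\lambda_i+a-b}{\lambda_i+a+b},&\frac\pi4<\tau<\frac\pi2,\\[2pt] \sum_{i=1}^n\arctan\lambda_i,&\tau=\frac\pi2.\end{cases}$$ There exist real constants $c_2$ and $c_{-1},c_{-2},\dots$, depending only on $n$, $\tau$ and $C_0$, with the following property. Let $K,\varepsilon\in\mathbb R$ be arbitrary constants, and let $u\in C^2(\mathbb R^n\setminus\overline{B_1})$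 be a radially symmetric classical solution of $$F_\tau(\lambda(D^2u))=C_0\quad\text{in }\mathbb R^n\setminus\overline{B_1},$$ where $\lambda(D^2u)$ are the $n$ eigenvalues of the Hessian matrix, such that on $\mathbb R^n\setminus\overline{B_1}$ one of the following holds: (i) $\tau=0$ and $D^2u>0$; (ii) $\tau\in(0,\frac\pi4)$ and $D^2u>(-a+b)I$; (iii) $\tau=\frac\pi4$ and $D^2u>-I$; (iv) $\tau\in(\frac\pi4,\frac\pi2)$, $D^2u>-(a+b)I$, and either $$D^2u\ge\begin{cases}-(a+bK)I,&n\le4,\\ -\left(a+\frac b{\sqrt3}+b\varepsilon\right)I,&n\ge5,\end{cases}\qquad\text{or}\qquad\left|\frac{bC_0}{\sqrt{a^2+1}}+\frac{n\pi}4\right|>\frac{n-2}2\pi;$$ (v) $\tau=\frac\pi2$ and either $$D^2u\ge\begin{cases}-KI,&n\le4,\\ -\left(\frac1{\sqrt3}+\varepsilon\right)I,&n\ge5,\end{cases}\qquad\text{or}\qquad|C_0|>\frac{n-2}2\pi.$$ Then $u$ is analytic at infinity, in the sense that there is a function $f(s,\theta)$, real-analytic in a neighbourhood of $\{0\}\times\{\theta\in\mathbb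 R^n:|\theta|=1\}$ in $\mathbb R\times\mathbb R^n$, with $u(x)=|x|^2f\left(\frac1{|x|},\frac x{|x|}\right)$ for all sufficiently large $|x|$. Moreover, there are real constants $c_0$ and $c$ (depending on $u$) such that, for all sufficiently large $|x|$, the series below converges and $$u(x)=c_2|x|^2+c_0+|x|^2\sum_{k=1}^{\infty}c_{-k}\left(c|x|^{-n}\right)^k.$$ -/

import Mathlib

open Real

/-- The Hessian matrix `D²u(x)` of a function on Euclidean space `ℝⁿ`. -/
noncomputable def hessian {n : ℕ} (u : EuclideanSpace ℝ (Fin n) → ℝ)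
    (x : EuclideanSpace ℝ (Fin n)) : Matrix (Fin n) (Fin n) ℝ :=
  Matrix.of fun i j =>
    iteratedFDeriv ℝ 2 u x ![EuclideanSpace.single i 1, EuclideanSpace.single j 1]

/-- `a = cot τ`. -/
noncomputable def parA (τ : ℝ) : ℝ := Real.cot τ

/-- `b = √|cot² τ - 1|`. -/
noncomputable def parB (τ : ℝ) : ℝ := √|Real.cot τ ^ 2 - 1|

/-- The operator `F_τ(λ)`, `τ ∈ [0, π/2]`, on vectors of eigenvalues. -/
noncomputable def opF {n : ℕ} (τ : ℝ) (l : Fin n → ℝ) : ℝ :=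
  if τ = 0 then
    1 / (n : ℝ) * ∑ i, Real.log (l i)
  else if τ < π / 4 then
    √(parA τ ^ 2 + 1) / (2 * parB τ) *
      ∑ i, Real.log ((l i + parA τ - parB τ) / (l i + parA τ + parB τ))
  else if τ = π / 4 then
    -√2 * ∑ i, 1 / (1 + l i)
  else if τ < π / 2 then
    √(parA τ ^ 2 + 1) / parB τ *
      ∑ i, Real.arctan ((l i + parA τ - parB τ) / (l i + parA τ + parB τ))
  else
    ∑ i, Real.arctan (l i)

/-- `u` is a classical (`C²`) solution of `F_τ(λ(D²u)) = C₀` in `ℝⁿ ∖ closure B₁`. The symmetry of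
`D²u(x)` follows from `u` being `C²`; it is only named in order to speak of the `n` eigenvalues,
counted with multiplicity. -/
def IsClassicalSolution {n : ℕ} (τ C₀ : ℝ) (u : EuclideanSpace ℝ (Fin n) → ℝ) : Prop :=
  ContDiffOn ℝ 2 u (Metric.closedBall 0 1)ᶜ ∧
    ∀ x, 1 < ‖x‖ → ∃ h : (hessian u x).IsHermitian, opF τ h.eigenvalues = C₀

/-- `u` is radially symmetric on `ℝⁿ ∖ closure B₁`. -/
def IsRadial {n : ℕ} (u : EuclideanSpace ℝ (Fin n) → ℝ) : Prop :=
  ∀ x y, 1 < ‖x‖ → ‖x‖ = ‖y‖ → u x = u y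

/-- `D²u > s I` in `ℝⁿ ∖ closure B₁`. -/
def HessGT {n : ℕ} (u : EuclideanSpace ℝ (Fin n) → ℝ) (s : ℝ) : Prop :=
  ∀ x, 1 < ‖x‖ → (hessian u x - s • (1 : Matrix (Fin n) (Fin n) ℝ)).PosDef

/-- `D²u ≥ s I` in `ℝⁿ ∖ closure B₁`. -/
def HessGE {n : ℕ} (u : EuclideanSpace ℝ (Fin n) → ℝ) (s : ℝ) : Prop :=
  ∀ x, 1 < ‖x‖ → (hessian u x - s • (1 : Matrix (Fin n) (Fin n) ℝ)).PosSemidef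

/-- The structural conditions (i)-(v) on `D²u`, one for each range of `τ`, with the lower-bound
constants `K` (dimension at most 4) and `ε` (dimension at least 5). In each of the cases all the
logarithms and quotients occurring in `F_τ(λ(D²u))` are genuinely defined. -/
def StructuralCondition {n : ℕ} (τ C₀ K ε : ℝ) (u : EuclideanSpace ℝ (Fin n) → ℝ) : Prop :=
  (τ = 0 ∧ HessGT u 0) ∨
  (0 < τ ∧ τ < π / 4 ∧ HessGT u (-parA τ + parB τ)) ∨
  (τ = π / 4 ∧ HessGT u (-1)) ∨
  (π / 4 < τ ∧ τ < π / 2 ∧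
    ((HessGT u (-(parA τ + parB τ)) ∧
        HessGE u (if n ≤ 4 then -(parA τ + parB τ * K)
          else -(parA τ + parB τ / √3 + parB τ * ε))) ∨
      (HessGT u (-(parA τ + parB τ)) ∧
        ((n : ℝ) - 2) / 2 * π < |parB τ * C₀ / √(parA τ ^ 2 + 1) + n * π / 4|))) ∨
  (τ = π / 2 ∧
    (HessGE u (if n ≤ 4 then -K else -(1 / √3 + ε)) ∨
      ((n : ℝ) - 2) / 2 * π < |C₀|))

/-- `u` is analytic at infinity with a pole of order at most `m`: in the polar coordinates
`s = 1/|x|`, `θ = x/|x|` the function `|x|^(-m) u(x)` extends real-analytically to a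
neighbourhood of the sphere at infinity `{s = 0, |θ| = 1}`. -/
def IsAnalyticAtInfinity {n : ℕ} (m : ℕ) (u : EuclideanSpace ℝ (Fin n) → ℝ) : Prop :=
  ∃ (f : ℝ × EuclideanSpace ℝ (Fin n) → ℝ) (R : ℝ),
    (∀ θ, ‖θ‖ = 1 → AnalyticAt ℝ f (0, θ)) ∧
      ∀ x, R < ‖x‖ → u x = ‖x‖ ^ m * f (‖x‖⁻¹, ‖x‖⁻¹ • x)

/-! Write `u = φ(r)` and `w = φ'/r`. The Hessian has the eigenvalue `y = φ'' = w + r w'` once and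
`w` with multiplicity `n - 1`, so the equation is autonomous in `log r`. In each regime it becomes
`G(y, w, …, w) = 0` with `G` symmetric and affine in each of its `n` arguments. For the diagonal
`H(w) = G(w, …, w)` this says `n H(w) + H'(w) (y - w) = 0`, that is, `(r ^ n H(w))' = 0`; hence
`H(w) = c r ^ (-n)`.

The structural conditions force `w` to converge to one fixed simple zero `w₀` of `H`, so `w = W(c r
^ (-n))` for large `r`, with `W` the local inverse of `H`. Integrating `φ' = r W` termwise gives the
expansion; no logarithm arises, since `2 - n k ≠ 0` for `n ≥ 3`. `H`, `w₀` and `W` depend only on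
`n`, `τ`, `C₀`; the solution enters through `c` and `c₀` alone.

The lemmas `hasFirstIntegral_*` treat four model equations, `isRadialEquation_*` reduce `F_τ` to
them by affine changes of variable, and `exists_expansion_of_firstIntegral` integrates. -/

open Filter Topology

/-! ### Expansion at infinity from a first integral. -/

/-- Termwise solution of the Euler type equation `2 T - n z T' = W` in power series. -/
lemma exists_powerSeries_solution {n : ℕ} (hn : 3 ≤ n) {W : ℝ → ℝ} (hW : AnalyticAt ℝ W 0) :
    ∃ (q : ℕ → ℝ) (ρ : ℝ), 0 < ρ ∧ AnalyticAt ℝ (fun z => ∑' k, q k * z ^ k) 0 ∧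
      ∀ z, |z| < ρ → Summable (fun k => q k * z ^ k) ∧
        ∃ T' : ℝ, HasDerivAt (fun z => ∑' k, q k * z ^ k) T' z ∧
          2 * (∑' k, q k * z ^ k) - n * z * T' = W z := by
  obtain ⟨p, r, hp⟩ := hW
  obtain ⟨ρ, hρ0, hρr⟩ : ∃ ρ : NNReal, 0 < ρ ∧ (ρ : ENNReal) < r := by
    obtain ⟨ρ, h1, h2⟩ := ENNReal.lt_iff_exists_nnreal_btwn.1 hp.r_pos
    exact ⟨ρ, by exact_mod_cast h1, h2⟩
  obtain ⟨C, hC0, hC⟩ := p.norm_mul_pow_le_of_lt_radius (hρr.trans_le hp.r_le)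
  have hρ : (0 : ℝ) < ρ := hρ0
  set a : ℕ → ℝ := fun k => p.coeff k with ha
  have haC : ∀ k, |a k| * (ρ : ℝ) ^ k ≤ C := fun k => by
    have := hC k
    rwa [FormalMultilinearSeries.norm_apply_eq_norm_coef, Real.norm_eq_abs] at this
  -- The bound by `1` controls `q k`, the bound by `k` controls `k * q k` in the differentiated
  -- series.
  have hden : ∀ k : ℕ, (k : ℝ) ≤ |2 - (n : ℝ) * k| ∧ 1 ≤ |2 - (n : ℝ) * k| := by
    intro k
    have hn' : (3 : ℝ) ≤ n := by exact_mod_cast hn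
    rcases Nat.eq_zero_or_pos k with rfl | hk
    · norm_num
    · have hk' : (1 : ℝ) ≤ k := by exact_mod_cast hk
      rw [abs_of_nonpos (by nlinarith)]
      constructor <;> nlinarith
  -- The operator `2 - n z d/dz` multiplies `z ^ k` by `2 - n k`.
  set q : ℕ → ℝ := fun k => a k / (2 - n * k) with hq
  have hne : ∀ k : ℕ, (2 - (n : ℝ) * k) ≠ 0 := fun k h => by
    have := (hden k).2
    rw [h] at this
    norm_num at this
  have hqa : ∀ k, |q k| ≤ |a k| := fun k => by
    rw [hq, abs_div]
    exact div_le_self (abs_nonneg _) (hden k).2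
  have hkqa : ∀ k : ℕ, k * |q k| ≤ |a k| := fun k => by
    simp only [hq, abs_div]
    rw [mul_div_assoc', div_le_iff₀ (by linarith [(hden k).2]), mul_comm]
    exact mul_le_mul_of_nonneg_left (hden k).1 (abs_nonneg _)
  -- Halving the radius turns the bound `|a k| ρ ^ k ≤ C` into a geometric majorant.
  have hpow : ∀ z : ℝ, |z| < ρ / 2 → ∀ k, |a k| * |z| ^ k ≤ C * (1 / 2) ^ k := by
    intro z hz k
    calc |a k| * |z| ^ k ≤ |a k| * (ρ / 2) ^ k := by gcongr
      _ = |a k| * ρ ^ k * (1 / 2) ^ k := by rw [div_eq_mul_one_div, mul_pow]; ring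
      _ ≤ _ := by gcongr; exact haC k
  have hgeo : Summable fun k : ℕ => C * (1 / 2 : ℝ) ^ k :=
    (summable_geometric_of_lt_one (by norm_num) (by norm_num)).mul_left C
  have hsum : ∀ z : ℝ, |z| < ρ / 2 → Summable (fun k => q k * z ^ k) := fun z hz =>
    hgeo.of_norm_bounded fun k => by
      rw [Real.norm_eq_abs, abs_mul, abs_pow]
      exact (mul_le_mul_of_nonneg_right (hqa k) (by positivity)).trans (hpow z hz k)
  refine ⟨q, ρ / 2, by positivity, ?_, fun z hz => ⟨hsum z hz, ?_⟩⟩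
  · have hrad : (ρ : ENNReal) ≤ (FormalMultilinearSeries.ofScalars ℝ q).radius := by
      refine FormalMultilinearSeries.le_radius_of_bound _ C fun k => ?_
      rw [FormalMultilinearSeries.ofScalars_norm]
      exact (mul_le_mul_of_nonneg_right (hqa k) (by positivity)).trans (haC k)
    have := (FormalMultilinearSeries.hasFPowerSeriesOnBall _
      (lt_of_lt_of_le (by exact_mod_cast hρ0) hrad)).analyticAt
    convert this using 2 with z
    rw [← FormalMultilinearSeries.ofScalarsSum, FormalMultilinearSeries.ofScalars_sum_eq]
    simp
  · have hz0 : z ∈ Metric.ball (0 : ℝ) (ρ / 2) := by simpa using hz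
    have hder : HasDerivAt (fun z => ∑' k, q k * z ^ k) (∑' k : ℕ, q k * (k * z ^ (k - 1))) z := by
      refine hasDerivAt_tsum_of_isPreconnected (t := Metric.ball (0 : ℝ) (ρ / 2)) (y₀ := 0)
        (hgeo.mul_left (2 / (ρ : ℝ))) Metric.isOpen_ball (convex_ball _ _).isPreconnected
        (fun k y _ => (hasDerivAt_pow k y).const_mul (q k)) (fun k y hy => ?_)
        (Metric.mem_ball_self (by positivity)) (hsum 0 (by simpa using hρ)) hz0
      have hy' : |y| < ρ / 2 := by simpa using hy
      rcases k with _ | k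
      · simp only [Nat.cast_zero, zero_mul, mul_zero, norm_zero]; positivity
      · rw [Real.norm_eq_abs, abs_mul, abs_mul, abs_pow, Nat.abs_cast, Nat.add_sub_cancel]
        calc |q (k + 1)| * (((k + 1 : ℕ) : ℝ) * |y| ^ k)
            = (((k + 1 : ℕ) : ℝ) * |q (k + 1)|) * |y| ^ k := by ring
          _ ≤ |a (k + 1)| * (ρ / 2) ^ k := by gcongr; exact hkqa _
          _ = 2 / ρ * (|a (k + 1)| * ρ ^ (k + 1) * (1 / 2) ^ (k + 1)) := by
              rw [div_eq_mul_one_div (ρ : ℝ) 2, mul_pow, pow_succ, pow_succ]; field_simp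
          _ ≤ _ := by gcongr; exact haC _
    refine ⟨_, hder, ?_⟩
    have hWsum : HasSum (fun k => a k * z ^ k) (W z) := by
      have hz1 : z ∈ Metric.eball (0 : ℝ) r := by
        refine Metric.mem_eball.2 (lt_trans ?_ hρr)
        rw [edist_dist, dist_zero_right, Real.norm_eq_abs]
        rw [ENNReal.ofReal_lt_coe_iff (by positivity)]
        linarith
      have := hp.hasSum hz1
      simpa [ha, mul_comm] using this
    have hs' : Summable fun k : ℕ => q k * (k * z ^ k) := hgeo.of_norm_bounded fun k => by
      rw [Real.norm_eq_abs, abs_mul, abs_mul, abs_pow, Nat.abs_cast]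
      calc |q k| * (k * |z| ^ k) = (k * |q k|) * |z| ^ k := by ring
        _ ≤ |a k| * |z| ^ k := by gcongr; exact hkqa _
        _ ≤ _ := hpow z hz k
    have e1 : z * (∑' k : ℕ, q k * (k * z ^ (k - 1))) = ∑' k : ℕ, q k * (k * z ^ k) := by
      rw [← tsum_mul_left]
      congr 1; ext k
      rcases k with _ | k
      · simp
      · rw [Nat.add_sub_cancel]; ring
    rw [mul_assoc, e1, ← tsum_mul_left, ← tsum_mul_left, ← ((hsum z hz).mul_left 2).tsum_sub
      (hs'.mul_left _), ← hWsum.tsum_eq]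
    congr 1; ext k
    have := hne k
    simp only [hq]
    field_simp

/-- A radial function whose slope `w = φ' / r` satisfies `r ^ n * H (w r) = c` and converges to a
simple zero of `H` has an expansion in powers of `c * r ^ (-n)`. -/
lemma exists_expansion_of_firstIntegral {n : ℕ} (hn : 3 ≤ n) {H : ℝ → ℝ} {w₀ : ℝ}
    (hH : AnalyticAt ℝ H w₀) (h0 : H w₀ = 0) (h1 : deriv H w₀ ≠ 0) :
    ∃ q : ℕ → ℝ, AnalyticAt ℝ (fun z => ∑' k, q k * z ^ k) 0 ∧
      ∀ (φ w : ℝ → ℝ) (c : ℝ), (∀ r, 1 < r → HasDerivAt φ (r * w r) r) →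
        Tendsto w atTop (𝓝 w₀) → (∀ r, 1 < r → r ^ n * H (w r) = c) →
        ∃ c₀ R : ℝ, 0 < R ∧ ∀ r, R < r → Summable (fun k => q k * (c * r ^ (-(n : ℤ))) ^ k) ∧
          φ r = c₀ + r ^ 2 * ∑' k, q k * (c * r ^ (-(n : ℤ))) ^ k := by
  set W : ℝ → ℝ := hH.hasStrictDerivAt.localInverse _ _ _ h1 with hWdef
  have hW : AnalyticAt ℝ W 0 := h0 ▸ hH.analyticAt_localInverse h1
  have hWl : ∀ᶠ x in 𝓝 w₀, W (H x) = x := HasStrictDerivAt.eventually_left_inverse ..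
  obtain ⟨q, ρ, hρ, hT, hq⟩ := exists_powerSeries_solution hn hW
  refine ⟨q, hT, fun φ w c hφ hw hc => ?_⟩
  have hz : Tendsto (fun r : ℝ => c * r ^ (-(n : ℤ))) atTop (𝓝 0) := by
    have : Tendsto (fun r : ℝ => r ^ (-(n : ℤ))) atTop (𝓝 0) :=
      tendsto_zpow_atTop_zero (by omega)
    simpa using this.const_mul c
  obtain ⟨R, hR⟩ := eventually_atTop.1 <| (hw.eventually hWl).and
    ((hz.eventually (Metric.ball_mem_nhds (0 : ℝ) hρ)).and (eventually_gt_atTop (1 : ℝ)))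
  have hR' : ∀ r, max R 1 < r → W (H (w r)) = w r ∧ |c * r ^ (-(n : ℤ))| < ρ ∧ 1 < r := by
    intro r hr
    obtain ⟨h1, h2, h3⟩ := hR r ((le_max_left _ _).trans hr.le)
    exact ⟨h1, by simpa using h2, h3⟩
  set T : ℝ → ℝ := fun z => ∑' k, q k * z ^ k with hTdef
  -- With `z = c r ^ (-n)`, the derivative of `r ^ 2 T(z)` is `r (2 T - n z T') = r W(z) = r w =
  -- φ'`.
  have hder : ∀ r, max R 1 < r →
      HasDerivAt (fun r => φ r - r ^ 2 * T (c * r ^ (-(n : ℤ)))) 0 r := by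
    intro r hr
    obtain ⟨hWr, hzr, hr1⟩ := hR' r hr
    have hr0 : r ≠ 0 := by positivity
    obtain ⟨-, T', hT', hTW⟩ := hq _ hzr
    have hzd : HasDerivAt (fun r : ℝ => c * r ^ (-(n : ℤ)))
        (c * (((-(n : ℤ) : ℤ) : ℝ) * r ^ (-(n : ℤ) - 1))) r :=
      (hasDerivAt_zpow _ _ (Or.inl hr0)).const_mul c
    have := (hφ r hr1).sub ((hasDerivAt_pow 2 r).mul (hT'.comp r hzd))
    refine this.congr_deriv ?_
    have hHz : H (w r) = c * r ^ (-(n : ℤ)) := by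
      rw [← hc r hr1, zpow_neg, zpow_natCast]
      field_simp
    rw [← hHz, hWr, hHz] at hTW
    rw [← hTW, zpow_sub_one₀ hr0]
    push_cast
    simp only [Function.comp_apply]
    field_simp
    ring
  obtain ⟨c₀, hc₀⟩ := isOpen_Ioi.exists_is_const_of_deriv_eq_zero (s := Set.Ioi (max R 1))
    (convex_Ioi _).isPreconnected
    (fun r hr => (hder r hr).differentiableAt.differentiableWithinAt)
    (fun r hr => (hder r hr).deriv)
  refine ⟨c₀, max R 1, lt_max_of_lt_right one_pos, fun r hr => ?_⟩
  obtain ⟨hWr, hzr, hr1⟩ := hR' r hr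
  exact ⟨(hq _ hzr).1, by linarith [hc₀ r hr]⟩

/-- The first integral of `n * H w + H' w * (r * w') = 0`. -/
lemma exists_firstIntegral {n : ℕ} {H H' w : ℝ → ℝ} (hn : n ≠ 0)
    (hH : ∀ r, 1 < r → HasDerivAt H (H' (w r)) (w r))
    (hw : ∀ r, 1 < r → DifferentiableAt ℝ w r)
    (he : ∀ r, 1 < r → n * H (w r) + H' (w r) * (r * deriv w r) = 0) :
    ∃ c, ∀ r, 1 < r → r ^ n * H (w r) = c := by
  have hder : ∀ r, 1 < r → HasDerivAt (fun r => r ^ n * H (w r)) 0 r := by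
    intro r hr
    have := (hasDerivAt_pow n r).mul ((hH r hr).comp r (hw r hr).hasDerivAt)
    refine this.congr_deriv ?_
    obtain ⟨m, rfl⟩ := Nat.exists_eq_succ_of_ne_zero hn
    have := he r hr
    simp only [Function.comp_apply, Nat.succ_eq_add_one, add_tsub_cancel_right] at this ⊢
    rw [pow_succ]
    linear_combination r ^ m * this
  exact isOpen_Ioi.exists_is_const_of_deriv_eq_zero (s := Set.Ioi (1 : ℝ))
    (convex_Ioi _).isPreconnected
    (fun r hr => (hder r hr).differentiableAt.differentiableWithinAt)
    (fun r hr => (hder r hr).deriv)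

lemma tendsto_of_firstIntegral {n : ℕ} (hn : n ≠ 0) {g : ℝ → ℝ} {c : ℝ}
    (h : ∀ r, 1 < r → r ^ n * g r = c) : Tendsto g atTop (𝓝 0) := by
  have : Tendsto (fun r : ℝ => c / r ^ n) atTop (𝓝 0) :=
    tendsto_const_nhds.div_atTop (tendsto_pow_atTop hn)
  refine this.congr' ?_
  filter_upwards [eventually_gt_atTop (1 : ℝ)] with r hr
  rw [← h r hr]
  field_simp

/-! ### Hessian and eigenvalues of a radial function. -/

/-- A diagonal matrix has its diagonal entries as eigenvalues, with multiplicity. -/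
lemma sum_eigenvalues_of_eq_diagonal {n : ℕ} {A : Matrix (Fin n) (Fin n) ℝ} (hA : A.IsHermitian)
    {d : Fin n → ℝ} (hd : A = Matrix.diagonal d) (g : ℝ → ℝ) :
    ∑ i, g (hA.eigenvalues i) = ∑ i, g (d i) := by
  -- `eigenvalues` comes in its own order, so the comparison is made between multisets of roots.
  have h1 := hA.roots_charpoly_eq_eigenvalues
  have h2 : A.charpoly.roots = Finset.univ.val.map d := by
    rw [hd, Matrix.charpoly_diagonal]
    have := Polynomial.roots_multiset_prod_X_sub_C (Finset.univ.val.map d)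
    rwa [Multiset.map_map] at this
  rw [h2] at h1
  have := congrArg (fun s => (s.map g).sum) h1
  rw [Multiset.map_map, Multiset.map_map] at this
  exact this.symm

lemma hasFDerivAt_radial {E : Type*} [NormedAddCommGroup E] [InnerProductSpace ℝ E]
    {ψ : ℝ → ℝ} {ψ' : ℝ} {x : E} (hx : x ≠ 0) (h : HasDerivAt ψ ψ' ‖x‖) :
    HasFDerivAt (fun y : E => ψ ‖y‖) ((ψ' / ‖x‖) • innerSL ℝ x) x := by
  have hx' : ‖x‖ ≠ 0 := norm_ne_zero_iff.2 hx
  have h1 : HasFDerivAt (fun y : E => √(‖y‖ ^ 2)) _ x :=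
    (hasStrictFDerivAt_norm_sq x).hasFDerivAt.sqrt (by positivity)
  simp only [Real.sqrt_sq (norm_nonneg _)] at h1
  refine (h.comp_hasFDerivAt x h1).congr_fderiv ?_
  ext v
  simp
  field_simp

/-- The slope `φ' / r` of the profile `φ r = u (r e)` of a radial function. -/
noncomputable def radialSlope {n : ℕ} (u : EuclideanSpace ℝ (Fin n) → ℝ) (i : Fin n) (r : ℝ) : ℝ :=
  deriv (fun s : ℝ => u (s • EuclideanSpace.single i 1)) r / r

section Radial

variable {n : ℕ} {u : EuclideanSpace ℝ (Fin n) → ℝ} (i₀ : Fin n)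

lemma norm_smul_single (r : ℝ) :
    ‖r • (EuclideanSpace.single i₀ 1 : EuclideanSpace ℝ (Fin n))‖ = |r| := by
  rw [norm_smul, PiLp.norm_single, norm_one, mul_one, Real.norm_eq_abs]

lemma IsRadial.eq_profile (h : IsRadial u) {x : EuclideanSpace ℝ (Fin n)} (hx : 1 < ‖x‖) :
    u x = u (‖x‖ • EuclideanSpace.single i₀ 1) :=
  h _ _ hx (by rw [norm_smul_single, abs_of_nonneg (norm_nonneg _)])

lemma contDiffOn_profile (h : ContDiffOn ℝ 2 u (Metric.closedBall 0 1)ᶜ) :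
    ContDiffOn ℝ 2 (fun s : ℝ => u (s • EuclideanSpace.single i₀ 1)) (Set.Ioi 1) := by
  refine h.comp (f := fun s : ℝ => s • (EuclideanSpace.single i₀ 1 : EuclideanSpace ℝ (Fin n)))
    (by fun_prop) fun r hr => ?_
  have : (1 : ℝ) < r := hr
  simp only [Set.mem_compl_iff, Metric.mem_closedBall, dist_zero_right, not_le, norm_smul_single]
  exact this.trans_le (le_abs_self r)

lemma hasDerivAt_profile (h : ContDiffOn ℝ 2 u (Metric.closedBall 0 1)ᶜ) {r : ℝ} (hr : 1 < r) :
    HasDerivAt (fun s : ℝ => u (s • EuclideanSpace.single i₀ 1)) (r * radialSlope u i₀ r) r := by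
  have h1 := ((contDiffOn_profile i₀ h).differentiableOn (by norm_num)).differentiableAt
    (isOpen_Ioi.mem_nhds hr)
  refine h1.hasDerivAt.congr_deriv ?_
  rw [radialSlope]
  field_simp

lemma differentiableAt_radialSlope (h : ContDiffOn ℝ 2 u (Metric.closedBall 0 1)ᶜ) {r : ℝ}
    (hr : 1 < r) : DifferentiableAt ℝ (radialSlope u i₀) r := by
  have h1 := (contDiffOn_profile i₀ h).deriv_of_isOpen (m := 1) isOpen_Ioi (by norm_num)
  exact ((h1.differentiableOn (by norm_num)).differentiableAt (isOpen_Ioi.mem_nhds hr)).div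
    differentiableAt_id (by positivity)

lemma IsRadial.fderiv_eq (hrad : IsRadial u) (h : ContDiffOn ℝ 2 u (Metric.closedBall 0 1)ᶜ)
    {x : EuclideanSpace ℝ (Fin n)} (hx : 1 < ‖x‖) :
    fderiv ℝ u x = radialSlope u i₀ ‖x‖ • innerSL ℝ x := by
  have hx0 : x ≠ 0 := norm_pos_iff.1 (one_pos.trans hx)
  have h1 := hasFDerivAt_radial hx0 (hasDerivAt_profile i₀ h hx)
  have h2 : u =ᶠ[𝓝 x] fun y => u (‖y‖ • EuclideanSpace.single i₀ 1) := by
    filter_upwards [continuous_norm.continuousAt.eventually (lt_mem_nhds hx)] with y hy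
    exact hrad.eq_profile i₀ hy
  rw [(h1.congr_of_eventuallyEq h2).fderiv]
  congr 1
  field_simp

/-- The Hessian of a radial function on a coordinate axis is diagonal, with entries `φ''` (once)
and `φ' / r`. -/
lemma IsRadial.hessian_eq (hrad : IsRadial u) (h : ContDiffOn ℝ 2 u (Metric.closedBall 0 1)ᶜ)
    {r : ℝ} (hr : 1 < r) :
    hessian u (r • EuclideanSpace.single i₀ 1) = Matrix.diagonal fun i =>
      if i = i₀ then radialSlope u i₀ r + r * deriv (radialSlope u i₀) r
      else radialSlope u i₀ r := by
  set x : EuclideanSpace ℝ (Fin n) := r • EuclideanSpace.single i₀ 1 with hxdef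
  have hxr : ‖x‖ = r := by rw [hxdef, norm_smul_single, abs_of_pos (by linarith)]
  have hx : 1 < ‖x‖ := hxr ▸ hr
  have hx0 : x ≠ 0 := norm_pos_iff.1 (one_pos.trans hx)
  have h2 : fderiv ℝ u =ᶠ[𝓝 x] fun y => radialSlope u i₀ ‖y‖ • innerSL ℝ y := by
    filter_upwards [continuous_norm.continuousAt.eventually (lt_mem_nhds hx)] with y hy
    exact hrad.fderiv_eq i₀ h hy
  -- Differentiating `w(|y|) y` gives `D²u = w I + (w' / r) x ⊗ x`.
  have h3 := (hasFDerivAt_radial hx0 (hxr ▸ (differentiableAt_radialSlope i₀ h hr).hasDerivAt)).smul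
    ((innerSL ℝ : EuclideanSpace ℝ (Fin n) →L[ℝ] _).hasFDerivAt (x := x))
  have h4 := (h3.congr_of_eventuallyEq h2).fderiv
  ext i j
  rw [hessian, Matrix.of_apply, iteratedFDeriv_two_apply, h4, hxr]
  have hS : ∀ k l : Fin n, inner ℝ (EuclideanSpace.single k 1 : EuclideanSpace ℝ (Fin n))
      (EuclideanSpace.single l 1) = if k = l then 1 else 0 := fun k l => by
    simp [EuclideanSpace.inner_single_left]
  change radialSlope u i₀ r * inner ℝ (EuclideanSpace.single i 1 : EuclideanSpace ℝ (Fin n))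
      (EuclideanSpace.single j 1) +
    (deriv (radialSlope u i₀) r / r * inner ℝ x (EuclideanSpace.single i 1)) *
      inner ℝ x (EuclideanSpace.single j 1) = _
  rw [hxdef, real_inner_smul_left, real_inner_smul_left, hS, hS, hS, Matrix.diagonal_apply]
  have hr0 : r ≠ 0 := by positivity
  by_cases hi : i = i₀
  · subst hi
    by_cases hj : i = j
    · simp only [hj, if_true]
      field_simp
    · simp [hj]
  · simp [hi, Ne.symm hi]

/-- Every branch of `opF` is a multiple of such a sum, so this turns the PDE into a relation between
`w` and `w + r w'`. Here `m = n - 1`. -/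
lemma IsRadial.sum_eigenvalues {m : ℕ} {u : EuclideanSpace ℝ (Fin (m + 1)) → ℝ}
    {i₀ : Fin (m + 1)} (hrad : IsRadial u) (h : ContDiffOn ℝ 2 u (Metric.closedBall 0 1)ᶜ)
    {r : ℝ} (hr : 1 < r) (hA : (hessian u (r • EuclideanSpace.single i₀ 1)).IsHermitian)
    (g : ℝ → ℝ) :
    ∑ i, g (hA.eigenvalues i) =
      g (radialSlope u i₀ r + r * deriv (radialSlope u i₀) r) + m * g (radialSlope u i₀ r) := by
  rw [sum_eigenvalues_of_eq_diagonal hA (hrad.hessian_eq i₀ h hr), Fin.sum_univ_succAbove _ i₀]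
  simp

lemma HessGT.lt_radialSlope [Nontrivial (Fin n)] {s : ℝ} (hu : HessGT u s) (hrad : IsRadial u)
    (h : ContDiffOn ℝ 2 u (Metric.closedBall 0 1)ᶜ) {r : ℝ} (hr : 1 < r) :
    s < radialSlope u i₀ r ∧
      s < radialSlope u i₀ r + r * deriv (radialSlope u i₀) r := by
  have h1 := hu (r • EuclideanSpace.single i₀ 1)
    (by rw [norm_smul_single]; exact hr.trans_le (le_abs_self r))
  rw [hrad.hessian_eq i₀ h hr] at h1
  -- The slope `w` itself is a diagonal entry only at an index off the axis.
  obtain ⟨j, hj⟩ := exists_ne i₀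
  have h2 := h1.diag_pos (i := i₀)
  have h3 := h1.diag_pos (i := j)
  simp only [Matrix.sub_apply, Matrix.diagonal_apply_eq, Matrix.smul_apply, Matrix.one_apply_eq,
    smul_eq_mul, mul_one, if_true, if_neg hj] at h2 h3
  constructor <;> linarith

lemma HessGE.le_radialSlope [Nontrivial (Fin n)] {s : ℝ} (hu : HessGE u s) (hrad : IsRadial u)
    (h : ContDiffOn ℝ 2 u (Metric.closedBall 0 1)ᶜ) {r : ℝ} (hr : 1 < r) :
    s ≤ radialSlope u i₀ r ∧
      s ≤ radialSlope u i₀ r + r * deriv (radialSlope u i₀) r := by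
  have h1 := hu (r • EuclideanSpace.single i₀ 1)
    (by rw [norm_smul_single]; exact hr.trans_le (le_abs_self r))
  rw [hrad.hessian_eq i₀ h hr] at h1
  obtain ⟨j, hj⟩ := exists_ne i₀
  have h2 := h1.diag_nonneg (i := i₀)
  have h3 := h1.diag_nonneg (i := j)
  simp only [Matrix.sub_apply, Matrix.diagonal_apply_eq, Matrix.smul_apply, Matrix.one_apply_eq,
    smul_eq_mul, mul_one, if_true, if_neg hj] at h2 h3
  constructor <;> linarith

end Radial

/-! ### First integrals of autonomous radial equations. -/

/-- The autonomous radial equation `P (w r) (w r + r * w' r)`, with a parameter `i`, has a first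
integral `r ^ n * H (w r)`, where `H` has a simple zero to which every solution converges. Neither
`H` nor the zero depends on `i`. -/
def HasFirstIntegral {ι : Type} (n : ℕ) (P : ι → ℝ → ℝ → Prop) : Prop :=
  ∃ (H : ℝ → ℝ) (w₀ : ℝ), AnalyticAt ℝ H w₀ ∧ H w₀ = 0 ∧ deriv H w₀ ≠ 0 ∧
    ∀ (i : ι) (w : ℝ → ℝ), (∀ r, 1 < r → DifferentiableAt ℝ w r) →
      (∀ r, 1 < r → P i (w r) (w r + r * deriv w r)) →
      Tendsto w atTop (𝓝 w₀) ∧ ∃ c, ∀ r, 1 < r → r ^ n * H (w r) = c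

namespace HasFirstIntegral

variable {ι κ : Type} {n : ℕ} {P : ι → ℝ → ℝ → Prop}

/-- Since `y - w = r w'`, the conservation law reduces to a pointwise identity `hP`. What is left is
`hlim`: the constraints in `P` must single out `w₀` among all ways for `H(w)` to tend to `0`. -/
lemma of_hasDerivAt (hn : n ≠ 0) {H H' : ℝ → ℝ} {w₀ : ℝ} (hH : AnalyticAt ℝ H w₀)
    (h0 : H w₀ = 0) (hd : ∀ w, HasDerivAt H (H' w) w) (h1 : H' w₀ ≠ 0)
    (hP : ∀ i w y, P i w y → n * H w + H' w * (y - w) = 0)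
    (hlim : ∀ i (w : ℝ → ℝ), (∀ r, 1 < r → ∃ y, P i (w r) y) →
      Tendsto (fun r => H (w r)) atTop (𝓝 0) → Tendsto w atTop (𝓝 w₀)) :
    HasFirstIntegral n P := by
  refine ⟨H, w₀, hH, h0, by rwa [(hd w₀).deriv], fun i w hw hPw => ?_⟩
  obtain ⟨c, hc⟩ := exists_firstIntegral hn (fun r _ => hd (w r)) hw fun r hr => by
    simpa using hP i _ _ (hPw r hr)
  exact ⟨hlim i w (fun r hr => ⟨_, hPw r hr⟩) (tendsto_of_firstIntegral hn hc), c, hc⟩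

/-- Covers values of the constant outside the range of the operator: there are no solutions, and any
`H` with a simple zero serves. -/
lemma of_forall_not (h : ∀ i w y, ¬ P i w y) : HasFirstIntegral n P :=
  ⟨id, 0, analyticAt_id, rfl, by simp, fun i w _ hP => (h i _ _ (hP 2 one_lt_two)).elim⟩

lemma mono (h : HasFirstIntegral n P) {Q : κ → ℝ → ℝ → Prop}
    (hQ : ∀ (j : κ), ∃ i, ∀ w y, Q j w y → P i w y) : HasFirstIntegral n Q := by
  obtain ⟨H, w₀, hH, h0, h1, h⟩ := h
  refine ⟨H, w₀, hH, h0, h1, fun j w hw hPw => ?_⟩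
  obtain ⟨i, hi⟩ := hQ j
  exact h i w hw fun r hr => hi _ _ (hPw r hr)

/-- The relation `y = w + r w'` is preserved when the same affine map is applied to `w` and `y`. -/
lemma comp_affine (h : HasFirstIntegral n P) {s : ℝ} (hs : s ≠ 0) (t : ℝ) :
    HasFirstIntegral n fun i w y => P i (s * w + t) (s * y + t) := by
  obtain ⟨H, w₀, hH, h0, h1, h⟩ := h
  have hw₀ : s * ((w₀ - t) / s) + t = w₀ := by field_simp; ring
  refine ⟨fun w => H (s * w + t), (w₀ - t) / s, ?_, by simpa only [hw₀], ?_, fun i w hw hPw => ?_⟩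
  · exact AnalyticAt.fun_comp (by rwa [hw₀]) (by fun_prop)
  · have hd : HasDerivAt (fun w => s * w + t) s ((w₀ - t) / s) := by
      simpa using ((hasDerivAt_id ((w₀ - t) / s)).const_mul s).add_const t
    have h2 : HasDerivAt (fun w => H (s * w + t)) (deriv H w₀ * s) ((w₀ - t) / s) :=
      HasDerivAt.comp (h₂ := H) _ (by rw [hw₀]; exact hH.differentiableAt.hasDerivAt) hd
    rw [h2.deriv]
    exact mul_ne_zero h1 hs
  · obtain ⟨h2, h3⟩ := h i (fun r => s * w r + t)
      (fun r hr => ((hw r hr).const_mul s).add_const t) fun r hr => by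
        have hd := ((hw r hr).hasDerivAt.const_mul s).add_const t
        rw [hd.deriv]
        convert hPw r hr using 1
        ring
    refine ⟨?_, h3⟩
    have := (h2.sub_const t).div_const s
    refine this.congr fun r => ?_
    field_simp
    ring

end HasFirstIntegral

/-! ### The four model equations. -/

lemma tendsto_of_pow_tendsto {m : ℕ} {f : ℝ → ℝ} {A : ℝ}
    (hf : ∀ᶠ r in atTop, 0 ≤ f r) (h : Tendsto (fun r => f r ^ (m + 1)) atTop (𝓝 A)) :
    Tendsto f atTop (𝓝 (A ^ ((m + 1 : ℕ) : ℝ)⁻¹)) := by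
  refine (h.rpow_const (p := ((m + 1 : ℕ) : ℝ)⁻¹) (Or.inr (by positivity))).congr' ?_
  filter_upwards [hf] with r hr
  exact Real.pow_rpow_inv_natCast hr (Nat.succ_ne_zero m)

/-- The Monge-Ampère equation. -/
lemma hasFirstIntegral_log (m : ℕ) (C : ℝ) :
    HasFirstIntegral (m + 1) fun (_ : Unit) w y => 0 < w ∧ 0 < y ∧ log y + m * log w = C := by
  set A : ℝ := exp C with hA
  have hA0 : 0 < A := exp_pos C
  -- Diagonal of `∏ λ_i - A`.
  refine HasFirstIntegral.of_hasDerivAt (H := fun w => w ^ (m + 1) - A)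
    (H' := fun w => (m + 1) * w ^ m) (w₀ := A ^ ((m + 1 : ℕ) : ℝ)⁻¹) (Nat.succ_ne_zero m)
    (by fun_prop) ?_ (fun w => ?_) (by positivity) ?_ ?_
  · rw [Real.rpow_inv_natCast_pow hA0.le (Nat.succ_ne_zero m), sub_self]
  · simpa using (hasDerivAt_pow (m + 1) w).sub_const A
  · rintro - w y ⟨hw, hy, h⟩
    have : y * w ^ m = A := by
      rw [hA, ← h, exp_add, exp_log hy, ← Real.log_pow, exp_log (by positivity)]
    push_cast
    linear_combination ((m : ℝ) + 1) * this
  · intro _ w hw h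
    refine tendsto_of_pow_tendsto ?_ (by simpa using h.add_const A)
    filter_upwards [eventually_gt_atTop 1] with r hr
    obtain ⟨y, hy, -⟩ := hw r hr
    exact hy.le

/-- Exponentiating gives `∏ (λ_i - b) = A ∏ (λ_i + b)`, and `H` is the diagonal of the difference of
the two sides. -/
lemma hasFirstIntegral_log_div (m : ℕ) {b : ℝ} (hb : 0 < b) (C : ℝ) :
    HasFirstIntegral (m + 1) fun (_ : Unit) p q => b < p ∧ b < q ∧
      log ((q - b) / (q + b)) + m * log ((p - b) / (p + b)) = C := by
  set A : ℝ := exp C with hA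
  have hA0 : 0 < A := exp_pos C
  have key : ∀ p q, b < p → b < q → log ((q - b) / (q + b)) + m * log ((p - b) / (p + b)) = C →
      (q - b) / (q + b) * ((p - b) / (p + b)) ^ m = A := by
    intro p q hp hq h
    have h1 : 0 < (p - b) / (p + b) := div_pos (by linarith) (by linarith)
    have h2 : 0 < (q - b) / (q + b) := div_pos (by linarith) (by linarith)
    rw [hA, ← h, exp_add, exp_log h2, ← Real.log_pow, exp_log (by positivity)]
  -- All the quotients lie in `(0, 1)`, so there is no solution when `A ≥ 1`.
  by_cases hA1 : A < 1
  swap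
  · refine HasFirstIntegral.of_forall_not ?_
    rintro - p q ⟨hp, hq, h⟩
    have h1 : 0 < (p - b) / (p + b) := div_pos (by linarith) (by linarith)
    have h2 : (p - b) / (p + b) < 1 := (div_lt_one (by linarith)).2 (by linarith)
    have h3 : 0 < (q - b) / (q + b) := div_pos (by linarith) (by linarith)
    have h4 : (q - b) / (q + b) < 1 := (div_lt_one (by linarith)).2 (by linarith)
    refine hA1 ?_
    rw [← key p q hp hq h]
    calc _ ≤ (q - b) / (q + b) * 1 := by gcongr; exact pow_le_one₀ h1.le h2.le
      _ < 1 := by linarith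
  set α : ℝ := A ^ ((m + 1 : ℕ) : ℝ)⁻¹ with hα
  have hα0 : 0 < α := by positivity
  have hα1 : α < 1 := Real.rpow_lt_one hA0.le hA1 (by positivity)
  have hαA : α ^ (m + 1) = A := Real.rpow_inv_natCast_pow hA0.le (Nat.succ_ne_zero m)
  have hα' : 0 < 1 - α := by linarith
  -- The zero `b (1 + α) / (1 - α)` solves `(p - b) / (p + b) = α`.
  have e1 : b * (1 + α) / (1 - α) - b = α * (2 * b / (1 - α)) := by field_simp; ring
  have e2 : b * (1 + α) / (1 - α) + b = 2 * b / (1 - α) := by field_simp; ring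
  refine HasFirstIntegral.of_hasDerivAt (H := fun p => (p - b) ^ (m + 1) - A * (p + b) ^ (m + 1))
    (H' := fun p => (m + 1) * (p - b) ^ m - A * ((m + 1) * (p + b) ^ m))
    (w₀ := b * (1 + α) / (1 - α)) (Nat.succ_ne_zero m) (by fun_prop) ?_ (fun p => ?_) ?_ ?_ ?_
  · rw [e1, e2, mul_pow, hαA, sub_self]
  · refine ((((hasDerivAt_id p).sub_const b).pow (m + 1)).sub
      ((((hasDerivAt_id p).add_const b).pow (m + 1)).const_mul A)).congr_deriv ?_
    simp
  · have : (m + 1) * (b * (1 + α) / (1 - α) - b) ^ m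
        - A * ((m + 1) * (b * (1 + α) / (1 - α) + b) ^ m)
        = (m + 1) * (α ^ m * (2 * b / (1 - α)) ^ m * (1 - α)) := by
      rw [e1, e2, mul_pow, ← hαA, pow_succ]; ring
    simp only [this]
    positivity
  · rintro - p q ⟨hp, hq, h⟩
    have := key p q hp hq h
    have h1 : p + b ≠ 0 := by linarith
    have h2 : q + b ≠ 0 := by linarith
    rw [div_pow, div_mul_div_comm, div_eq_iff (by positivity)] at this
    push_cast
    linear_combination ((m : ℝ) + 1) * this
  · intro _ w hw h
    have hwb : ∀ r, 1 < r → b < w r := fun r hr => by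
      obtain ⟨y, hy, -⟩ := hw r hr
      exact hy
    have h1 : Tendsto (fun r => ((w r - b) / (w r + b)) ^ (m + 1)) atTop (𝓝 A) := by
      rw [tendsto_iff_norm_sub_tendsto_zero]
      -- No upper bound on `w` is known yet; dividing by `(w + b) ^ (m + 1) ≥ (2 b) ^ (m + 1)`
      -- passes to the bounded quotient.
      have h2 : Tendsto (fun r => |(w r - b) ^ (m + 1) - A * (w r + b) ^ (m + 1)|
          / (2 * b) ^ (m + 1)) atTop (𝓝 0) := by
        simpa using h.abs.div_const ((2 * b) ^ (m + 1))
      refine squeeze_zero' (Eventually.of_forall fun _ => norm_nonneg _) ?_ h2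
      filter_upwards [eventually_gt_atTop 1] with r hr
      have hr1 := hwb r hr
      have hr2 : 0 < w r + b := by linarith
      have : ((w r - b) / (w r + b)) ^ (m + 1) - A =
          ((w r - b) ^ (m + 1) - A * (w r + b) ^ (m + 1)) / (w r + b) ^ (m + 1) := by
        rw [div_pow]; field_simp
      rw [this, Real.norm_eq_abs, abs_div, abs_of_pos (pow_pos hr2 _)]
      gcongr
      linarith
    have h3 : Tendsto (fun r => (w r - b) / (w r + b)) atTop (𝓝 α) := by
      refine tendsto_of_pow_tendsto ?_ h1
      filter_upwards [eventually_gt_atTop 1] with r hr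
      have := hwb r hr
      exact (div_pos (by linarith) (by linarith)).le
    refine (((h3.const_add 1).const_mul b).div (h3.const_sub 1) hα'.ne').congr' ?_
    filter_upwards [eventually_gt_atTop 1] with r hr
    have := hwb r hr
    have hr2 : w r + b ≠ 0 := by linarith
    have hr3 : 1 - (w r - b) / (w r + b) = 2 * b / (w r + b) := by field_simp; ring
    simp only [Pi.div_apply, hr3]
    field_simp
    ring

/-- Clearing denominators, `H` is the diagonal of `M ∏ v_i - ∑_i ∏_{j ≠ i} v_j`, with `n = k + 2`.
-/
lemma hasFirstIntegral_inv (k : ℕ) (M : ℝ) :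
    HasFirstIntegral (k + 2) fun (_ : Unit) v y => 0 < v ∧ 0 < y ∧
      1 / y + (k + 1) * (1 / v) = M := by
  by_cases hM : 0 < M
  swap
  · refine HasFirstIntegral.of_forall_not ?_
    rintro - v y ⟨hv, hy, h⟩
    exact hM (h ▸ by positivity)
  refine HasFirstIntegral.of_hasDerivAt
    (H := fun v => M * v ^ (k + 2) - (k + 2) * v ^ (k + 1))
    (H' := fun v => (k + 2) * v ^ k * (M * v - (k + 1)))
    (w₀ := (k + 2) / M) (by omega) (by fun_prop) ?_ (fun v => ?_) ?_ ?_ ?_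
  · rw [pow_succ]; field_simp; ring
  · have := ((hasDerivAt_pow (k + 2) v).const_mul M).sub
      ((hasDerivAt_pow (k + 1) v).const_mul ((k : ℝ) + 2))
    refine this.congr_deriv ?_
    simp only [Nat.add_sub_cancel, show k + 2 - 1 = k + 1 by omega]
    push_cast
    ring
  · have : M * ((k + 2) / M) - (k + 1) = 1 := by field_simp; ring
    simp only [this]
    positivity
  · rintro - v y ⟨hv, hy, h⟩
    have : M * v * y = v + (k + 1) * y := by rw [← h]; field_simp
    push_cast
    linear_combination ((k : ℝ) + 2) * v ^ k * this
  · intro _ v hv h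
    -- Dropping `1 / y > 0` from the equation bounds `v` away from the spurious zero `v = 0` of `H`.
    have hvM : ∀ r, 1 < r → (k + 1) / M < v r := fun r hr => by
      obtain ⟨y, hv, hy, h⟩ := hv r hr
      rw [div_lt_iff₀ hM, ← h]
      have : v r * (1 / y + (k + 1) * (1 / v r)) = (k + 1) + v r * (1 / y) := by field_simp; ring
      rw [this]
      have : 0 < v r * (1 / y) := by positivity
      linarith
    have hM' : (0 : ℝ) < (k + 1) / M := by positivity
    have h2 : Tendsto (fun r => |M * v r ^ (k + 2) - (k + 2) * v r ^ (k + 1)|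
        / ((k + 1) / M) ^ (k + 1)) atTop (𝓝 0) := by
      simpa using h.abs.div_const (((k + 1) / M) ^ (k + 1))
    have h1 : Tendsto (fun r => M * v r) atTop (𝓝 (k + 2)) := by
      rw [tendsto_iff_norm_sub_tendsto_zero]
      refine squeeze_zero' (Eventually.of_forall fun _ => norm_nonneg _) ?_ h2
      filter_upwards [eventually_gt_atTop 1] with r hr
      have hr1 := hvM r hr
      have hr2 : 0 < v r := hM'.trans hr1
      have : M * v r - (k + 2) =
          (M * v r ^ (k + 2) - (k + 2) * v r ^ (k + 1)) / v r ^ (k + 1) := by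
        rw [pow_succ _ (k + 1)]; field_simp
      rw [this, Real.norm_eq_abs, abs_div, abs_of_pos (pow_pos hr2 _)]
      gcongr
    refine (h1.div_const M).congr fun r => ?_
    field_simp

/-- Excludes the zeros `±π` of the sine: by Jordan's inequality, `sin |x| ≥ 2 δ / π` when `π / 2 ≤
|x| ≤ π - δ`. On `|x| ≤ π / 2` the same inequality gives the conclusion. -/
lemma abs_le_of_abs_sin_lt {x δ : ℝ} (hx : |x| ≤ π - δ) (h : |sin x| < 2 / π * δ) :
    |x| ≤ π / 2 * |sin x| := by
  have hπ := pi_pos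
  have hδ : 0 < δ := by
    by_contra hδ
    have : 2 / π * δ ≤ 0 := mul_nonpos_of_nonneg_of_nonpos (by positivity) (not_lt.1 hδ)
    linarith [abs_nonneg (sin x)]
  have hs : |sin x| = sin |x| := by
    rcases le_total 0 x with h0 | h0
    · rw [abs_of_nonneg h0] at hx ⊢
      exact abs_of_nonneg (sin_nonneg_of_nonneg_of_le_pi h0 (by linarith))
    · rw [abs_of_nonpos h0] at hx ⊢
      rw [sin_neg, abs_of_nonpos (sin_nonpos_of_nonpos_of_neg_pi_le h0 (by linarith))]
  rw [hs] at h ⊢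
  rcases le_total |x| (π / 2) with h1 | h1
  · have := mul_le_sin (abs_nonneg x) h1
    calc |x| = π / 2 * (2 / π * |x|) := by field_simp
      _ ≤ _ := by gcongr
  · have := mul_le_sin (x := π - |x|) (by linarith) (by linarith)
    rw [sin_pi_sub] at this
    have h2 : 2 / π * δ ≤ 2 / π * (π - |x|) := by gcongr; linarith
    linarith

/-- The special Lagrangian equation, where the parameter `δ > 0` measures the distance to the
critical phase. -/
lemma hasFirstIntegral_arctan (m : ℕ) (Θ : ℝ) :
    HasFirstIntegral (m + 1) fun (δ : {δ : ℝ // 0 < δ}) p y =>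
      arctan y + m * arctan p = Θ ∧ |arctan p - arctan y| ≤ π - δ := by
  -- `Θ` is a sum of `m + 1` arctangents, so otherwise there are no solutions.
  by_cases hΘ : |Θ / (m + 1)| < π / 2
  swap
  · refine HasFirstIntegral.of_forall_not ?_
    rintro - p y ⟨h, -⟩
    refine hΘ ?_
    rw [← h, abs_div, div_lt_iff₀ (by positivity), abs_of_pos (a := (m : ℝ) + 1) (by positivity),
      abs_lt]
    have hm : (0 : ℝ) ≤ m := m.cast_nonneg
    have := arctan_lt_pi_div_two p
    have := neg_pi_div_two_lt_arctan p
    constructor <;> nlinarith [arctan_lt_pi_div_two y, neg_pi_div_two_lt_arctan y]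
  obtain ⟨hΘ1, hΘ2⟩ := abs_lt.1 hΘ
  have hcos : 0 < cos (Θ / (m + 1)) := cos_pos_of_mem_Ioo ⟨hΘ1, hΘ2⟩
  have harc : arctan (tan (Θ / (m + 1))) = Θ / (m + 1) := arctan_tan hΘ1 hΘ2
  have hm1 : ((m : ℝ) + 1) * (Θ / (m + 1)) - Θ = 0 := by field_simp; ring
  have hsq : ∀ p : ℝ, 0 < √(1 + p ^ 2) := fun p => by positivity
  have hsq2 : ∀ p : ℝ, √(1 + p ^ 2) ^ 2 = 1 + p ^ 2 := fun p => Real.sq_sqrt (by positivity)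
  -- Diagonal of the imaginary part of `exp(-iΘ) ∏ (1 + i λ_j)`.
  refine HasFirstIntegral.of_hasDerivAt
    (H := fun p => √(1 + p ^ 2) ^ (m + 1) * sin ((m + 1) * arctan p - Θ))
    (H' := fun p => (m + 1) * √(1 + p ^ 2) ^ m / √(1 + p ^ 2) *
      (p * sin ((m + 1) * arctan p - Θ) + cos ((m + 1) * arctan p - Θ)))
    (w₀ := tan (Θ / (m + 1))) (Nat.succ_ne_zero m) ?_ ?_ (fun p => ?_) ?_ ?_ ?_
  · have h1 : ContDiff ℝ ⊤ fun p : ℝ => √(1 + p ^ 2) ^ (m + 1) * sin ((m + 1) * arctan p - Θ) :=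
      ((ContDiff.sqrt (by fun_prop) fun p => by positivity).pow _).mul
        (((contDiff_const.mul contDiff_arctan).sub contDiff_const).sin)
    exact h1.contDiffAt.analyticAt
  · simp only [harc, hm1, sin_zero, mul_zero]
  · have h1 : HasDerivAt (fun p : ℝ => √(1 + p ^ 2)) (2 * p / (2 * √(1 + p ^ 2))) p := by
      have : HasDerivAt (fun p : ℝ => 1 + p ^ 2) (2 * p) p := by
        simpa using (hasDerivAt_pow 2 p).const_add 1
      exact this.sqrt (by positivity)
    have h2 := (((hasDerivAt_arctan p).const_mul ((m : ℝ) + 1)).sub_const Θ).sin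
    refine ((h1.pow (m + 1)).mul h2).congr_deriv ?_
    have h3 : 1 / (1 + p ^ 2) = 1 / √(1 + p ^ 2) ^ 2 := by rw [hsq2]
    rw [h3]
    have := (hsq p).ne'
    simp only [Nat.add_sub_cancel]
    simp only [Pi.pow_apply]
    push_cast
    field_simp
    ring
  · simp only [harc, hm1, sin_zero, cos_zero, mul_zero, zero_add, mul_one]
    have := hsq (tan (Θ / (m + 1)))
    positivity
  · rintro - p y ⟨h, -⟩
    have e : ((m : ℝ) + 1) * arctan p - Θ = arctan p - arctan y := by rw [← h]; ring
    simp only [e, sin_sub, cos_sub, sin_arctan, cos_arctan]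
    have h1 := (hsq p).ne'
    have h2 := (hsq y).ne'
    push_cast
    field_simp
    linear_combination (√(1 + p ^ 2) ^ m * (m + 1) * (p - y)) * hsq2 p
  -- The factor `√(1 + p ^ 2) ^ (m + 1)` is at least `1`, so the sine tends to `0`; its argument
  -- equals `arctan p - arctan y`, which `δ` keeps away from `±π`, so the argument tends to `0` too.
  · rintro ⟨δ, hδ⟩ w hw h
    have hψ : ∀ r, 1 < r → |(m + 1) * arctan (w r) - Θ| ≤ π - δ := fun r hr => by
      obtain ⟨y, h, hy⟩ := hw r hr
      have e : ((m : ℝ) + 1) * arctan (w r) - Θ = arctan (w r) - arctan y := by rw [← h]; ring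
      rwa [e]
    have hsin : Tendsto (fun r => |sin ((m + 1) * arctan (w r) - Θ)|) atTop (𝓝 0) := by
      refine squeeze_zero (fun _ => abs_nonneg _) (fun r => ?_) (abs_zero (α := ℝ) ▸ h.abs)
      rw [abs_mul]
      refine le_mul_of_one_le_left (abs_nonneg _) ?_
      rw [abs_of_pos (pow_pos (hsq _) _)]
      exact one_le_pow₀ (Real.one_le_sqrt.2 (by nlinarith [sq_nonneg (w r)]))
    have h1 : Tendsto (fun r => (m + 1) * arctan (w r) - Θ) atTop (𝓝 0) := by
      rw [tendsto_zero_iff_abs_tendsto_zero]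
      refine squeeze_zero' (Eventually.of_forall fun _ => abs_nonneg _) ?_
        (by simpa using hsin.const_mul (π / 2))
      filter_upwards [eventually_gt_atTop 1, hsin.eventually_lt_const
        (show 0 < 2 / π * δ by have := pi_pos; positivity)] with r hr hr2
      exact abs_le_of_abs_sin_lt (hψ r hr) hr2
    have h2 : Tendsto (fun r => arctan (w r)) atTop (𝓝 (Θ / (m + 1))) := by
      have := (h1.add_const Θ).div_const ((m : ℝ) + 1)
      rw [zero_add] at this
      refine this.congr fun r => ?_
      field_simp
      ring
    refine ((continuousAt_tan.2 hcos.ne').tendsto.comp h2).congr fun r => ?_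
    exact tan_arctan _

/-! ### Reduction of `F_τ` to the model equations. -/

lemma parB_pos {τ : ℝ} (h0 : 0 < τ) (h1 : τ < π / 2) (h : τ ≠ π / 4) : 0 < parB τ := by
  have hs : 0 < sin τ := sin_pos_of_pos_of_lt_pi h0 (by linarith)
  refine Real.sqrt_pos.2 (abs_pos.2 fun hc => h ?_)
  -- `cot² τ = 1` means `cos 2τ = 0`.
  have h2 : cos (2 * τ) = cos (π / 2) := by
    rw [Real.cot_eq_cos_div_sin] at hc
    field_simp at hc
    rw [cos_pi_div_two, cos_two_mul']
    linarith
  have := injOn_cos ⟨by linarith, by linarith⟩ ⟨by linarith, by linarith⟩ h2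
  linarith

lemma arctan_sub_one_div_add_one {x : ℝ} (hx : -1 < x) :
    arctan ((x - 1) / (x + 1)) = arctan x - π / 4 := by
  have := arctan_add (x := x) (y := -1) (by linarith)
  rw [arctan_neg, arctan_one] at this
  rw [sub_eq_add_neg (arctan x), this]
  congr 1
  ring

/-- `P` is, up to its parameter, a consequence of the equation and of the structural condition. -/
def IsRadialEquation {ι : Type} {n : ℕ} (τ C₀ : ℝ) (i₀ : Fin n) (P : ι → ℝ → ℝ → Prop) : Prop :=
  ∀ (K ε : ℝ) (u : EuclideanSpace ℝ (Fin n) → ℝ),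
    IsClassicalSolution τ C₀ u → IsRadial u → StructuralCondition τ C₀ K ε u →
      ∃ i, ∀ r, 1 < r → P i (radialSlope u i₀ r)
        (radialSlope u i₀ r + r * deriv (radialSlope u i₀) r)

lemma IsClassicalSolution.exists_isHermitian {n : ℕ} {τ C₀ : ℝ}
    {u : EuclideanSpace ℝ (Fin n) → ℝ} (h : IsClassicalSolution τ C₀ u) (i₀ : Fin n) {r : ℝ}
    (hr : 1 < r) : ∃ h : (hessian u (r • EuclideanSpace.single i₀ 1)).IsHermitian,
      opF τ h.eigenvalues = C₀ :=
  h.2 _ (by rw [norm_smul_single]; exact hr.trans_le (le_abs_self r))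

lemma isRadialEquation_zero {m : ℕ} (hm : 2 ≤ m) (C₀ : ℝ) (i₀ : Fin (m + 1)) :
    IsRadialEquation 0 C₀ i₀ fun (_ : Unit) w y =>
      0 < w ∧ 0 < y ∧ log y + m * log w = (m + 1) * C₀ := by
  intro K ε u hu hrad hs
  have : Nontrivial (Fin (m + 1)) := Fin.nontrivial_iff_two_le.2 (by omega)
  have hπ := pi_pos
  have hgt : HessGT u 0 := by
    rcases hs with h | h | h | h | h
    · exact h.2
    · exact absurd h.1 (lt_irrefl 0)
    · linarith [h.1]
    · linarith [h.1]
    · linarith [h.1]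
  refine ⟨(), fun r hr => ?_⟩
  obtain ⟨h1, h2⟩ := hgt.lt_radialSlope i₀ hrad hu.1 hr
  obtain ⟨hA, hF⟩ := hu.exists_isHermitian i₀ hr
  rw [opF, if_pos rfl, hrad.sum_eigenvalues hu.1 hr hA log] at hF
  refine ⟨h1, h2, ?_⟩
  rw [← hF]
  push_cast
  field_simp

/-- The factors `1 *` match the form produced by `comp_affine` with `s = 1`. -/
lemma isRadialEquation_of_lt {m : ℕ} (hm : 2 ≤ m) {τ : ℝ} (h0 : 0 < τ) (hτ : τ < π / 4) (C₀ : ℝ)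
    (i₀ : Fin (m + 1)) :
    IsRadialEquation τ C₀ i₀ fun (_ : Unit) w y =>
      parB τ < 1 * w + parA τ ∧ parB τ < 1 * y + parA τ ∧
      log ((1 * y + parA τ - parB τ) / (1 * y + parA τ + parB τ)) +
        m * log ((1 * w + parA τ - parB τ) / (1 * w + parA τ + parB τ)) =
      C₀ / (√(parA τ ^ 2 + 1) / (2 * parB τ)) := by
  intro K ε u hu hrad hs
  have : Nontrivial (Fin (m + 1)) := Fin.nontrivial_iff_two_le.2 (by omega)
  have hπ := pi_pos
  have hb := parB_pos h0 (by linarith) hτ.ne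
  have hgt : HessGT u (-parA τ + parB τ) := by
    rcases hs with h | h | h | h | h
    · linarith [h.1]
    · exact h.2.2
    · linarith [h.1]
    · linarith [h.1]
    · linarith [h.1]
  refine ⟨(), fun r hr => ?_⟩
  obtain ⟨h1, h2⟩ := hgt.lt_radialSlope i₀ hrad hu.1 hr
  obtain ⟨hA, hF⟩ := hu.exists_isHermitian i₀ hr
  rw [opF, if_neg h0.ne', if_pos hτ, hrad.sum_eigenvalues hu.1 hr hA
    (fun l => log ((l + parA τ - parB τ) / (l + parA τ + parB τ)))] at hF
  simp only [one_mul]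
  refine ⟨by linarith, by linarith, ?_⟩
  rw [← hF, mul_div_cancel_left₀ _ (by positivity)]

lemma isRadialEquation_pi_div_four {m : ℕ} (hm : 2 ≤ m) (C₀ : ℝ) (i₀ : Fin (m + 1)) :
    IsRadialEquation (π / 4) C₀ i₀ fun (_ : Unit) w y =>
      0 < 1 * w + 1 ∧ 0 < 1 * y + 1 ∧
        1 / (1 * y + 1) + m * (1 / (1 * w + 1)) = C₀ / (-√2) := by
  intro K ε u hu hrad hs
  have : Nontrivial (Fin (m + 1)) := Fin.nontrivial_iff_two_le.2 (by omega)
  have hπ := pi_pos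
  have hgt : HessGT u (-1) := by
    rcases hs with h | h | h | h | h
    · linarith [h.1]
    · linarith [h.2.1]
    · exact h.2
    · linarith [h.1]
    · linarith [h.1]
  refine ⟨(), fun r hr => ?_⟩
  obtain ⟨h1, h2⟩ := hgt.lt_radialSlope i₀ hrad hu.1 hr
  obtain ⟨hA, hF⟩ := hu.exists_isHermitian i₀ hr
  rw [opF, if_neg (by positivity), if_neg (lt_irrefl _), if_pos rfl,
    hrad.sum_eigenvalues hu.1 hr hA (fun l => 1 / (1 + l))] at hF
  simp only [one_mul]
  refine ⟨by linarith, by linarith, ?_⟩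
  rw [← hF, mul_div_cancel_left₀ _ (by simp)]
  simp only [add_comm]

/-- In the variable `(λ + a) / b` this is the special Lagrangian equation with phase shifted by `n π
/ 4`. The bound `D²u > -(a + b) I` puts all arctangents in `(-π/4, π/2)`, so they differ by less
than `π - π/4`. -/
lemma isRadialEquation_of_gt {m : ℕ} (hm : 2 ≤ m) {τ : ℝ} (h0 : π / 4 < τ) (hτ : τ < π / 2)
    (C₀ : ℝ) (i₀ : Fin (m + 1)) :
    IsRadialEquation τ C₀ i₀ fun (δ : {δ : ℝ // 0 < δ}) w y =>
      arctan ((parB τ)⁻¹ * y + parA τ / parB τ) +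
          m * arctan ((parB τ)⁻¹ * w + parA τ / parB τ) =
        C₀ / (√(parA τ ^ 2 + 1) / parB τ) + (m + 1) * (π / 4) ∧
      |arctan ((parB τ)⁻¹ * w + parA τ / parB τ) - arctan ((parB τ)⁻¹ * y + parA τ / parB τ)| ≤
        π - δ := by
  intro K ε u hu hrad hs
  have : Nontrivial (Fin (m + 1)) := Fin.nontrivial_iff_two_le.2 (by omega)
  have hπ := pi_pos
  have hb := parB_pos (by linarith) hτ h0.ne'
  have hgt : HessGT u (-(parA τ + parB τ)) := by
    rcases hs with h | h | h | h | h
    · linarith [h.1]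
    · linarith [h.2.1]
    · linarith [h.1]
    · exact h.2.2.elim And.left And.left
    · linarith [h.1]
  have key : ∀ l, -(parA τ + parB τ) < l → -1 < (parB τ)⁻¹ * l + parA τ / parB τ ∧
      arctan ((l + parA τ - parB τ) / (l + parA τ + parB τ)) =
        arctan ((parB τ)⁻¹ * l + parA τ / parB τ) - π / 4 := by
    intro l hl
    have e : (parB τ)⁻¹ * l + parA τ / parB τ = (l + parA τ) / parB τ := by field_simp
    have h1 : -1 < (parB τ)⁻¹ * l + parA τ / parB τ := by
      rw [e, lt_div_iff₀ hb]; linarith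
    refine ⟨h1, ?_⟩
    rw [← arctan_sub_one_div_add_one h1, e]
    congr 1
    have : l + parA τ + parB τ ≠ 0 := by linarith
    field_simp
  refine ⟨⟨π / 4, by positivity⟩, fun r hr => ?_⟩
  obtain ⟨h1, h2⟩ := hgt.lt_radialSlope i₀ hrad hu.1 hr
  obtain ⟨hA, hF⟩ := hu.exists_isHermitian i₀ hr
  rw [opF, if_neg (by linarith), if_neg (by linarith), if_neg h0.ne', if_pos hτ,
    hrad.sum_eigenvalues hu.1 hr hA
    (fun l => arctan ((l + parA τ - parB τ) / (l + parA τ + parB τ)))] at hF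
  obtain ⟨h3, h4⟩ := key _ h1
  obtain ⟨h5, h6⟩ := key _ h2
  rw [h4, h6] at hF
  constructor
  · rw [← hF, mul_div_cancel_left₀ _ (by positivity)]
    ring
  · have h7 := arctan_strictMono h3
    have h8 := arctan_strictMono h5
    rw [arctan_neg, arctan_one] at h7 h8
    rw [abs_le]
    constructor <;> linarith [arctan_lt_pi_div_two ((parB τ)⁻¹ * radialSlope u i₀ r +
      parA τ / parB τ), arctan_lt_pi_div_two ((parB τ)⁻¹ * (radialSlope u i₀ r +
        r * deriv (radialSlope u i₀) r) + parA τ / parB τ)]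

/-- A lower bound `s` on the Hessian puts the arctangents in `[arctan s, π/2)`, whence `δ = π/2 +
arctan s`. If `|C₀| > (n - 2) π / 2`, say with `C₀ > 0`, each arctangent exceeds `C₀ - (n - 1) π /
2`, so two of them differ by less than `n π / 2 - C₀ = π - δ` with `δ = C₀ - (n - 2) π / 2`. -/
lemma isRadialEquation_pi_div_two {m : ℕ} (hm : 2 ≤ m) (C₀ : ℝ) (i₀ : Fin (m + 1)) :
    IsRadialEquation (π / 2) C₀ i₀ fun (δ : {δ : ℝ // 0 < δ}) w y =>
      arctan y + m * arctan w = C₀ ∧ |arctan w - arctan y| ≤ π - δ := by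
  intro K ε u hu hrad hs
  have : Nontrivial (Fin (m + 1)) := Fin.nontrivial_iff_two_le.2 (by omega)
  have hπ := pi_pos
  have heq : ∀ r, 1 < r → arctan (radialSlope u i₀ r + r * deriv (radialSlope u i₀) r) +
      m * arctan (radialSlope u i₀ r) = C₀ := by
    intro r hr
    obtain ⟨hA, hF⟩ := hu.exists_isHermitian i₀ hr
    rwa [opF, if_neg (by linarith), if_neg (by linarith), if_neg (by linarith), if_neg (by linarith),
      hrad.sum_eigenvalues hu.1 hr hA arctan] at hF
  have hcond : (∃ s, HessGE u s) ∨ (((m + 1 : ℕ) : ℝ) - 2) / 2 * π < |C₀| := by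
    rcases hs with h | h | h | h | h
    · linarith [h.1]
    · linarith [h.2.1]
    · linarith [h.1]
    · linarith [h.2.1]
    · exact h.2.imp_left fun h => ⟨_, h⟩
  rcases hcond with ⟨s, hs⟩ | hC
  · refine ⟨⟨π / 2 + arctan s, by linarith [neg_pi_div_two_lt_arctan s]⟩, fun r hr =>
      ⟨heq r hr, ?_⟩⟩
    obtain ⟨h1, h2⟩ := hs.le_radialSlope i₀ hrad hu.1 hr
    have h3 := arctan_strictMono.monotone h1
    have h4 := arctan_strictMono.monotone h2
    rw [abs_le]
    constructor <;> linarith [arctan_lt_pi_div_two (radialSlope u i₀ r), arctan_lt_pi_div_two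
      (radialSlope u i₀ r + r * deriv (radialSlope u i₀) r)]
  · refine ⟨⟨|C₀| - (((m + 1 : ℕ) : ℝ) - 2) / 2 * π, by linarith⟩, fun r hr => ⟨heq r hr, ?_⟩⟩
    have h := heq r hr
    have h1 := arctan_lt_pi_div_two (radialSlope u i₀ r)
    have h2 := neg_pi_div_two_lt_arctan (radialSlope u i₀ r)
    have h3 := arctan_lt_pi_div_two (radialSlope u i₀ r + r * deriv (radialSlope u i₀) r)
    have h4 := neg_pi_div_two_lt_arctan (radialSlope u i₀ r + r * deriv (radialSlope u i₀) r)
    have hm' : (2 : ℝ) ≤ m := by exact_mod_cast hm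
    push_cast
    rw [abs_le]
    rcases abs_cases C₀ with ⟨h5, -⟩ | ⟨h5, -⟩ <;> rw [h5] <;> constructor <;> nlinarith

/-- `P` is fixed before `K`, `ε` and `u`, which affect only its parameter; this makes the
coefficients of the expansion uniform. -/
lemma exists_isRadialEquation {m : ℕ} (hm : 2 ≤ m) {τ : ℝ} (hτ : τ ∈ Set.Icc 0 (π / 2)) (C₀ : ℝ)
    (i₀ : Fin (m + 1)) : ∃ (ι : Type) (P : ι → ℝ → ℝ → Prop),
      HasFirstIntegral (m + 1) P ∧ IsRadialEquation τ C₀ i₀ P := by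
  obtain ⟨h0, h2⟩ := hτ
  rcases h0.eq_or_lt with rfl | h0
  · exact ⟨_, _, hasFirstIntegral_log m _, isRadialEquation_zero hm C₀ i₀⟩
  rcases lt_trichotomy τ (π / 4) with h1 | rfl | h1
  · exact ⟨_, _, (hasFirstIntegral_log_div m (parB_pos h0 (by linarith) h1.ne) _).comp_affine
      one_ne_zero _, isRadialEquation_of_lt hm h0 h1 C₀ i₀⟩
  · obtain ⟨k, rfl⟩ : ∃ k, m = k + 1 := ⟨m - 1, by omega⟩
    have := isRadialEquation_pi_div_four hm C₀ i₀
    push_cast at this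
    exact ⟨_, _, (hasFirstIntegral_inv k _).comp_affine one_ne_zero _, this⟩
  rcases h2.eq_or_lt with rfl | h2
  · exact ⟨_, _, hasFirstIntegral_arctan m _, isRadialEquation_pi_div_two hm C₀ i₀⟩
  · exact ⟨_, _, (hasFirstIntegral_arctan m _).comp_affine
      (inv_ne_zero (parB_pos h0 h2 h1.ne').ne') _, isRadialEquation_of_gt hm h1 h2 C₀ i₀⟩

/-! ### The expansion and analyticity at infinity. -/

theorem theorem1p1 (n : ℕ) (hn : 3 ≤ n) (τ : ℝ) (hτ : τ ∈ Set.Icc 0 (π / 2)) (C₀ : ℝ) :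
    ∃ (c₂ : ℝ) (d : ℕ → ℝ), ∀ (K ε : ℝ) (u : EuclideanSpace ℝ (Fin n) → ℝ),
      IsClassicalSolution τ C₀ u → IsRadial u → StructuralCondition τ C₀ K ε u →
        IsAnalyticAtInfinity 2 u ∧
        ∃ c₀ c R : ℝ, ∀ x : EuclideanSpace ℝ (Fin n), R < ‖x‖ →
          Summable (fun k : ℕ => d (k + 1) * (c * ‖x‖ ^ (-(n : ℤ))) ^ (k + 1)) ∧
          u x = c₂ * ‖x‖ ^ 2 + c₀ +
            ‖x‖ ^ 2 * ∑' k : ℕ, d (k + 1) * (c * ‖x‖ ^ (-(n : ℤ))) ^ (k + 1) := by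
  obtain ⟨m, rfl⟩ : ∃ m, n = m + 1 := ⟨n - 1, by omega⟩
  obtain ⟨ι, P, ⟨H, w₀, hH, h0, h1, hlim⟩, hP⟩ :=
    exists_isRadialEquation (by omega) hτ C₀ (0 : Fin (m + 1))
  obtain ⟨q, hT, hq⟩ := exists_expansion_of_firstIntegral hn hH h0 h1
  refine ⟨q 0, q, fun K ε u hu hrad hs => ?_⟩
  obtain ⟨i, hi⟩ := hP K ε u hu hrad hs
  obtain ⟨hw, c, hc⟩ := hlim i _ (fun r hr => differentiableAt_radialSlope 0 hu.1 hr) hi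
  obtain ⟨c₀, R, -, hR⟩ := hq _ _ c (fun r hr => hasDerivAt_profile 0 hu.1 hr) hw hc
  have hux : ∀ x : EuclideanSpace ℝ (Fin (m + 1)), max R 1 < ‖x‖ →
      Summable (fun k => q k * (c * ‖x‖ ^ (-((m + 1 : ℕ) : ℤ))) ^ k) ∧
      u x = c₀ + ‖x‖ ^ 2 * ∑' k, q k * (c * ‖x‖ ^ (-((m + 1 : ℕ) : ℤ))) ^ k := by
    intro x hx
    rw [hrad.eq_profile 0 ((le_max_right _ _).trans_lt hx)]
    exact hR _ ((le_max_left _ _).trans_lt hx)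
  constructor
  -- `f(s, θ) = c₀ s ^ 2 + T(c s ^ n)`, where `T(z) = ∑ q k z ^ k`.
  · refine ⟨fun p => c₀ * p.1 ^ 2 + ∑' k, q k * (c * p.1 ^ (m + 1)) ^ k, max R 1, fun θ _ => ?_,
      fun x hx => ?_⟩
    · refine AnalyticAt.add (analyticAt_const.mul (analyticAt_fst.pow 2)) ?_
      exact AnalyticAt.comp (g := fun z => ∑' k, q k * z ^ k)
        (f := fun p : ℝ × EuclideanSpace ℝ (Fin (m + 1)) => c * p.1 ^ (m + 1))
        (by simpa using hT) (analyticAt_const.mul (analyticAt_fst.pow _))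
    · have hx0 : ‖x‖ ≠ 0 := by linarith [le_max_right R 1]
      rw [(hux x hx).2, zpow_neg, zpow_natCast]
      simp only [inv_pow]
      field_simp
  · refine ⟨c₀, c, max R 1, fun x hx => ?_⟩
    obtain ⟨hs, hu⟩ := hux x hx
    refine ⟨(summable_nat_add_iff 1).2 hs, ?_⟩
    -- The term `k = 0` supplies `c₂ = q 0`.
    rw [hu, hs.tsum_eq_zero_add, pow_zero]
    ring
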